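/- Fix an integer $n\ge 0$ and a polynomial $p(t)=at+b\in\mathbb{Z}[t]$ of degree $1$. For a locally Noetherian scheme $S$, consider pairs $(C,i)$ consisting of a flat $S$-scheme $C$ and a finite $S$-morphism $i\colon C\to\mathbb{P}^n_S$ such that for every $s\in S$: 1. the fiber $C_s$ is a Cohen--Macaulay scheme (all its local rings are Cohen--Macaulay) of pure dimension $1$ (all its irreducible components have dimension $1$); 2. the induced morphism $i_s\colon C_s\to\mathbb{P}^n_{\kappa(s)}$ is an isomorphism onto its scheme-theoretic image away from a finite set of closed points; 3. the coherent sheaf $(i_*\mathcal{O}_C)_s=(i_s)_*\mathcal{O}_{C_s}$ on $\mathbb{P}^n_{\kappa(s)}$ has Hilbert polynomial $p(t)$, that is, $\dim_{\kappa(s)}H^0\bigl(\mathbb{P}^n_{\kappa(s)},((i_s)_*\mathcal{O}_{C_s})(d)\bigr)=p(d)$ for all sufficiently large integers $d$. (The set $CM(S)$ consists of the isomorphism classes of such pairs, where an isomorphism $(C_1,i_1)\to(C_2,i_2)$ is an $S$-isomorphism $\beta\colon C_1\to C_2$ with $i_2\circ\beta=i_1$.) Then: (a) For every such pair $(C,i)$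 over $S$, every $S$-automorphism $\alpha$ of $C$ with $i\circ\alpha=i$ is the identity of $C$. (b) For any two such pairs $(C_1,i_1)$ and $(C_2,i_2)$ over $S$, there is at most one $S$-isomorphism $\beta\colon C_1\to C_2$ with $i_2\circ\beta=i_1$. -/

import Mathlib

open CategoryTheory CategoryTheory.Limits AlgebraicGeometry

universe u

noncomputable section

namespace CMCurves

/-! ### Projective space over a scheme -/

/-- The homogeneous coordinate ring `ℤ[x₀, …, xₙ]` (with `ℤ` lifted to the universe `u`). -/
abbrev CoordRing (n : ℕ) : Type u := MvPolynomial (Fin (n + 1)) (ULift.{u} ℤ)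

/-- The grading of `ℤ[x₀, …, xₙ]` by degree. -/
abbrev grading (n : ℕ) : ℕ → Submodule (ULift.{u} ℤ) (CoordRing.{u} n) :=
  MvPolynomial.homogeneousSubmodule (Fin (n + 1)) (ULift.{u} ℤ)

instance gradingGradedAlgebra (n : ℕ) : GradedAlgebra (grading.{u} n) := MvPolynomial.gradedAlgebra

/-- Projective space `ℙⁿ` over the integers, `Proj ℤ[x₀, …, xₙ]`. -/
abbrev ProjInt (n : ℕ) : Scheme.{u} := Proj (grading.{u} n)

/-- Projective space `ℙⁿ_S = S ×_ℤ ℙⁿ_ℤ` over a scheme `S`. -/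
def PSpace (n : ℕ) (S : Scheme.{u}) : Scheme.{u} :=
  pullback (terminal.from S) (terminal.from (ProjInt.{u} n))

/-- The structure morphism `ℙⁿ_S ⟶ S`. -/
def PSpace.toBase (n : ℕ) (S : Scheme.{u}) : PSpace n S ⟶ S := pullback.fst _ _

/-- The projection `ℙⁿ_S ⟶ ℙⁿ_ℤ`. -/
def PSpace.toProjInt (n : ℕ) (S : Scheme.{u}) : PSpace n S ⟶ ProjInt.{u} n := pullback.snd _ _

/-- `ℙⁿ_S` as an `S`-scheme. -/
def PSpace.over (n : ℕ) (S : Scheme.{u}) : Over S := Over.mk (PSpace.toBase n S)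

/-- The standard affine open `D₊(x_j)` of `ℙⁿ_ℤ`. -/
abbrev chart (n : ℕ) (j : Fin (n + 1)) : (ProjInt.{u} n).Opens :=
  Proj.basicOpen (grading.{u} n) (MvPolynomial.X j)

theorem X_mem_grading (n : ℕ) (j : Fin (n + 1)) :
    (MvPolynomial.X j : CoordRing.{u} n) ∈ grading.{u} n 1 :=
  MvPolynomial.isHomogeneous_X _ j

/-- The fraction `x_j / x_k` of degree `0`. -/
def coordFraction (n : ℕ) (j k : Fin (n + 1)) :
    HomogeneousLocalization.Away (grading.{u} n) (MvPolynomial.X k) :=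
  HomogeneousLocalization.Away.mk (grading.{u} n) (X_mem_grading n k) 1 (MvPolynomial.X j)
    ((one_smul ℕ 1).symm ▸ X_mem_grading n j)

/-- The regular function `x_j / x_k` on `D₊(x_k)`. -/
def coordRatio (n : ℕ) (j k : Fin (n + 1)) : Γ(ProjInt.{u} n, chart n k) :=
  (Proj.awayToSection (grading.{u} n) (MvPolynomial.X k)).hom (coordFraction n j k)

/-! ### Sections of Serre twists and the Hilbert polynomial -/

/-- For a scheme `X` over `Spec K`, the `K`-algebra structure on the sections over an open set. -/
@[reducible] def sectionsAlgebra {K : CommRingCat.{u}} {X : Scheme.{u}} (π : X ⟶ Spec K)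
    (U : X.Opens) : Algebra K Γ(X, U) :=
  ((Scheme.ΓSpecIso K).inv ≫ π.appTop ≫ X.presheaf.map (homOfLE le_top).op).hom.toAlgebra

section Twist

variable {n : ℕ} {K : CommRingCat.{u}} {X : Scheme.{u}}

/-- The open set `U_j = g⁻¹(D₊(x_j))` of `X`. -/
abbrev chartPreimage (g : X ⟶ ProjInt.{u} n) (j : Fin (n + 1)) : X.Opens := g ⁻¹ᵁ chart n j

/-- The pullback to `U_k` of the function `x_j / x_k`. -/
def ratioPullback (g : X ⟶ ProjInt.{u} n) (j k : Fin (n + 1)) : Γ(X, chartPreimage g k) :=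
  (g.app (chart n k)).hom (coordRatio n j k)

/-- The global sections of `g^* 𝒪(d)`, as a vector space over `K`. The line bundle `𝒪(d)` is
trivial on `D₊(x_j)` with generator `x_j ^ d`, so that a global section of its pullback is a family
`s_j ∈ Γ(X, U_j)` (standing for `s_j x_j ^ d`) with `s_k = (x_j / x_k) ^ d s_j` on `U_j ∩ U_k`. -/
def twistedSections (π : X ⟶ Spec K) (g : X ⟶ ProjInt.{u} n) (d : ℕ) :
    letI := fun j => sectionsAlgebra π (chartPreimage g j)
    Submodule K (∀ j : Fin (n + 1), Γ(X, chartPreimage g j)) :=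
  letI := fun j => sectionsAlgebra π (chartPreimage g j)
  { carrier := {s | ∀ j k : Fin (n + 1),
      (X.presheaf.map (homOfLE (inf_le_right :
          chartPreimage g j ⊓ chartPreimage g k ≤ chartPreimage g k)).op).hom (s k) =
        (X.presheaf.map (homOfLE (inf_le_right :
            chartPreimage g j ⊓ chartPreimage g k ≤ chartPreimage g k)).op).hom
            (ratioPullback g j k) ^ d *
          (X.presheaf.map (homOfLE (inf_le_left :
            chartPreimage g j ⊓ chartPreimage g k ≤ chartPreimage g j)).op).hom (s j)}
    zero_mem' := fun j k => by simp
    add_mem' := fun {s t} hs ht j k => by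
      simp only [Pi.add_apply, map_add, hs j k, ht j k, mul_add]
    smul_mem' := fun c s hs j k => by
      have key : ∀ (U V : X.Opens) (h : V ≤ U) (y : Γ(X, U)),
          letI := sectionsAlgebra π U
          letI := sectionsAlgebra π V
          (X.presheaf.map (homOfLE h).op).hom (c • y) =
            c • (X.presheaf.map (homOfLE h).op).hom y := by
        intro U V h y
        let := sectionsAlgebra π U
        let := sectionsAlgebra π V
        rw [Algebra.smul_def, Algebra.smul_def, map_mul]
        congr 1
        change ((Scheme.ΓSpecIso K).inv ≫ π.appTop ≫ X.presheaf.map (homOfLE le_top).op ≫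
          X.presheaf.map (homOfLE h).op).hom c = _
        rw [← Functor.map_comp]
        rfl
      let := sectionsAlgebra π (chartPreimage g j ⊓ chartPreimage g k)
      simp only [Pi.smul_apply]
      rw [key _ _ inf_le_right, key _ _ inf_le_left, hs j k, mul_smul_comm] }

/-- `p` is the Hilbert polynomial of `𝒪_X` with respect to `g^* 𝒪(1)`, equivalently of `g_* 𝒪_X`,
where `X` is a scheme over (the spectrum of) a field `K`: for all large `d`, the space of global
sections of `(g_* 𝒪_X)(d)`, that is, of `g^* 𝒪(d)`, has finite dimension `p(d)`. -/
def HasHilbertPolynomial (π : X ⟶ Spec K) (g : X ⟶ ProjInt.{u} n) (p : Polynomial ℤ) : Prop :=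
  letI := fun j => sectionsAlgebra π (chartPreimage g j)
  ∃ d₀ : ℕ, ∀ d : ℕ, d₀ ≤ d →
    Module.Finite K (twistedSections π g d) ∧
      (Module.finrank K (twistedSections π g d) : ℤ) = p.eval (d : ℤ)

end Twist

/-! ### Cohen–Macaulay schemes, pure dimension -/

/-- A Noetherian local ring is Cohen–Macaulay if its depth equals its dimension, that is, if its
maximal ideal contains a regular sequence whose length is the dimension of the ring. -/
def IsCohenMacaulayLocal (R : Type u) [CommRing R] [IsLocalRing R] : Prop :=
  IsNoetherianRing R ∧ ∃ rs : List R, (∀ r ∈ rs, r ∈ IsLocalRing.maximalIdeal R) ∧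
    RingTheory.Sequence.IsRegular R rs ∧ ((rs.length : ℕ) : WithBot ℕ∞) = ringKrullDim R

/-- A scheme is Cohen–Macaulay if all its local rings are. -/
def IsCohenMacaulayScheme (X : Scheme.{u}) : Prop :=
  ∀ x : X, IsCohenMacaulayLocal (X.presheaf.stalk x)

/-- A scheme has pure dimension `m` if all its irreducible components have dimension `m`. -/
def HasPureDimension (X : Scheme.{u}) (m : ℕ) : Prop :=
  ∀ Z ∈ irreducibleComponents X, topologicalKrullDim Z = m

/-- The morphism `f : X ⟶ Y` is an isomorphism onto its (scheme-theoretic) image away from a finite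
set of closed points: there is an open subscheme `V` of the image, the complement of finitely many
closed points, over which `X` is isomorphic to the image. -/
def IsIsoOntoImageAwayFromFinite {X Y : Scheme.{u}} (f : X ⟶ Y) : Prop :=
  ∃ V : f.image.Opens, ((V : Set f.image)ᶜ).Finite ∧
    (∀ x ∉ V, IsClosed ({x} : Set f.image)) ∧ IsIso (f.toImage ∣_ V)

/-! ### Families of Cohen–Macaulay curves -/

/-- The morphism `i_s : C_s ⟶ ℙⁿ_{κ(s)}` on fibers over `s ∈ S` that is induced by an `S`-morphism
`i : C ⟶ ℙⁿ_S`. -/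
def fiberMap {n : ℕ} {S : Scheme.{u}} {C : Over S} (i : C ⟶ PSpace.over n S) (s : S) :
    C.hom.fiber s ⟶ PSpace n (Spec (S.residueField s)) :=
  pullback.lift (C.hom.fiberToSpecResidueField s)
    (C.hom.fiberι s ≫ i.left ≫ PSpace.toProjInt n S) (terminal.hom_ext _ _)

/-- Pairs `(C, i)` representing the elements of `CM_{ℙⁿ}^p(S)`: a flat `S`-scheme `C` and a finite
`S`-morphism `i : C ⟶ ℙⁿ_S` whose fibers `(C_s, i_s)` are Cohen–Macaulay curves with Hilbert
polynomial `p`. -/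
structure CMPair (n : ℕ) (p : Polynomial ℤ) (S : Scheme.{u}) where
  /-- The `S`-scheme `C`. -/
  C : Over S
  /-- The `S`-morphism `i`. -/
  i : C ⟶ PSpace.over n S
  flat : Flat C.hom
  finite : IsFinite i.left
  cohenMacaulay : ∀ s : S, IsCohenMacaulayScheme (C.hom.fiber s)
  pureDimension : ∀ s : S, HasPureDimension (C.hom.fiber s) 1
  isoOntoImage : ∀ s : S, IsIsoOntoImageAwayFromFinite (fiberMap i s)
  hilbertPolynomial : ∀ s : S, HasHilbertPolynomial (C.hom.fiberToSpecResidueField s)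
    (fiberMap i s ≫ PSpace.toProjInt n (Spec (S.residueField s))) p

end CMCurves

end

/-! An endomorphism of `C` over `ℙⁿ_S` is locally an `A`-algebra endomorphism `σ` of `B`, where `A`
and `B` are the functions on an affine open of `ℙⁿ_S` and on its preimage in `C`. The difference `σ
- id` is only `A`-linear, but it kills `1`, and this alone forces it to vanish.

On a fiber, let `D` be linear with `D 1 = 0`. Where `i_s` is an isomorphism onto its image, every
function on `C_s` comes locally from `ℙⁿ`, so `D b` is zero there. It can only be supported over
closed points, and at those the local rings of a Cohen–Macaulay curve have positive depth, so `D b =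
0` (`unitDetectsEnd_app`).

Flatness lifts this to the family (`linearMap_tensor_eq_zero`): the vanishing of all maps `B → B ⊗
M` that kill `1` passes from residue fields to their submodules `R/p`, then through extensions to
every finite `M`, in particular to `M = R`. Uniqueness of isomorphisms follows by applying this to
`β₁` followed by the inverse of `β₂`. -/

namespace CMCurves

open TensorProduct

/-! ### Linear maps killing the unit, and dévissage from the fibers -/

/-- A ring homomorphism `f : A → B` such that every `A`-linear endomorphism of `B` killing `1`
vanishes. -/
def UnitDetectsEnd {A B : Type*} [CommRing A] [CommRing B] (f : A →+* B) : Prop :=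
  ∀ D : B →+ B, (∀ a b, D (f a * b) = f a * D b) → D 1 = 0 → D = 0

theorem UnitDetectsEnd.of_ringEquiv {A B A' B' : Type*} [CommRing A] [CommRing B] [CommRing A']
    [CommRing B'] {f : A →+* B} {f' : A' →+* B'} (h : UnitDetectsEnd f') (g : A →+* A')
    (hg : Function.Surjective g) (e : B ≃+* B') (hfg : ∀ a, e (f a) = f' (g a)) :
    UnitDetectsEnd f := by
  intro D hD hD1
  have key := h ((e : B →+ B').comp (D.comp (e.symm : B' →+ B))) (fun a b => by
    obtain ⟨a, rfl⟩ := hg a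
    have : e.symm (f' (g a) * b) = f a * e.symm b := by
      rw [map_mul, ← hfg, e.symm_apply_apply]
    simp [this, hD, hfg]) (by simp [hD1])
  ext b
  have := DFunLike.congr_fun key (e b)
  simpa using this

/-- An `A`-linear map `B → B ⊗ K` killing `1` vanishes if `A ⊗ K → B ⊗ K` detects
endomorphisms. -/
theorem UnitDetectsEnd.linearMap_eq_zero {R A B K : Type*} [CommRing R] [CommRing A] [CommRing B]
    [CommRing K] [Algebra R A] [Algebra R B] [Algebra A B] [IsScalarTower R A B] [Algebra R K]
    (h : UnitDetectsEnd
      (Algebra.TensorProduct.map (IsScalarTower.toAlgHom R A B) (AlgHom.id R K)).toRingHom)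
    (φ : B →ₗ[A] B ⊗[R] K) (hφ : φ 1 = 0) : φ = 0 := by
  -- `D` is the `K`-linear extension of `φ`; it recovers `φ` on the elements `b ⊗ 1`.
  let D : B ⊗[R] K →ₗ[R] B ⊗[R] K := TensorProduct.lift
    (((LinearMap.mul R (B ⊗[R] K)).compl₂
      (Algebra.TensorProduct.includeRight : K →ₐ[R] B ⊗[R] K).toLinearMap).comp
        (φ.restrictScalars R))
  have hD : ∀ b k, D (b ⊗ₜ k) = φ b * (1 ⊗ₜ k) := fun b k => by simp [D]
  have hlin : ∀ (a : A) (b : B), φ (algebraMap A B a * b) = (algebraMap A B a ⊗ₜ 1) * φ b := by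
    intro a b
    rw [← Algebra.smul_def, map_smul]
    induction φ b with
    | zero => simp
    | tmul x y => simp [Algebra.smul_def]
    | add x y hx hy => rw [smul_add, hx, hy, mul_add]
  have key := h D.toAddMonoidHom (fun a b => by
    change D (_ * _) = _ * D b
    induction a with
    | zero => simp
    | add x y hx hy => simp only [map_add, add_mul, hx, hy]
    | tmul a c =>
      induction b with
      | zero => simp
      | add x y hx hy => simp only [map_add, mul_add, hx, hy]
      | tmul b k =>
        have e1 : ((algebraMap A B a) ⊗ₜ[R] c : B ⊗[R] K) =
            (algebraMap A B a ⊗ₜ 1) * (1 ⊗ₜ c) := by simp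
        have e2 : ((1 : B) ⊗ₜ[R] (c * k) : B ⊗[R] K) = (1 ⊗ₜ c) * (1 ⊗ₜ k) := by simp
        simp only [AlgHom.toRingHom_eq_coe, RingHom.coe_coe, Algebra.TensorProduct.map_tmul,
          IsScalarTower.coe_toAlgHom', AlgHom.coe_id, id_eq, Algebra.TensorProduct.tmul_mul_tmul,
          hD, hlin]
        rw [e1, e2]
        ring) (by
    change D ((1 : B) ⊗ₜ (1 : K)) = 0
    rw [hD, hφ, zero_mul])
  ext b
  have := DFunLike.congr_fun key (b ⊗ₜ 1)
  change D (b ⊗ₜ 1) = 0 at this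
  rw [hD, ← Algebra.TensorProduct.one_def, mul_one] at this
  simpa using this

/-- Dévissage: over a Noetherian ring, a linear map out of a flat algebra that vanishes on the unit
is zero if this holds for the fibers. -/
theorem linearMap_tensor_eq_zero {R A B : Type u} [CommRing R] [IsNoetherianRing R] [CommRing A]
    [CommRing B] [Algebra R A] [Algebra R B] [Algebra A B] [IsScalarTower R A B] [Module.Flat R B]
    (H : ∀ p : PrimeSpectrum R, ∃ (K : Type u) (_ : CommRing K) (_ : Algebra R K),
      RingHom.ker (algebraMap R K) = p.asIdeal ∧ ∀ φ : B →ₗ[A] B ⊗[R] K, φ 1 = 0 → φ = 0)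
    (M : Type u) [AddCommGroup M] [Module R M] [hM : Module.Finite R M] :
    ∀ φ : B →ₗ[A] B ⊗[R] M, φ 1 = 0 → φ = 0 := by
  -- By flatness of `B` the property descends to submodules.
  have of_injective : ∀ (N N' : Type u) [AddCommGroup N] [Module R N] [AddCommGroup N']
      [Module R N'] (f : N →ₗ[R] N'), Function.Injective f →
      (∀ φ : B →ₗ[A] B ⊗[R] N', φ 1 = 0 → φ = 0) →
      ∀ φ : B →ₗ[A] B ⊗[R] N, φ 1 = 0 → φ = 0 := by
    intro N N' _ _ _ _ f hf h φ hφ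
    have h0 := h ((TensorProduct.AlgebraTensorModule.lTensor A B f).comp φ) (by simp [hφ])
    ext b
    refine Module.Flat.lTensor_preserves_injective_linearMap (M := B) f hf ?_
    simpa using DFunLike.congr_fun h0 b
  induction hM using IsNoetherianRing.induction_on_isQuotientEquivQuotientPrime R with
  | subsingleton N =>
    intro φ _
    ext b
    exact Subsingleton.elim _ _
  | quotient N p e =>
    obtain ⟨K, _, _, hK, h⟩ := H p
    have hle : p.asIdeal ≤ LinearMap.ker (Algebra.linearMap R K) := fun x hx => by
      rw [← hK] at hx
      exact hx
    -- Since `R → K` has kernel `p`, the quotient `R/p` embeds in `K`.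
    refine of_injective N K ((Submodule.liftQ p.asIdeal (Algebra.linearMap R K) hle).comp
      e.toLinearMap) ?_ h
    rw [LinearMap.coe_comp]
    refine Function.Injective.comp ?_ e.injective
    rw [← LinearMap.ker_eq_bot]
    refine Submodule.ker_liftQ_eq_bot _ _ _ fun x hx => ?_
    rw [← hK]
    exact hx
  | exact N₁ N₂ N₃ f g hf hg hfg h₁ h₃ =>
    intro φ hφ
    have h0 := h₃ ((TensorProduct.AlgebraTensorModule.lTensor A B g).comp φ) (by simp [hφ])
    have hinj := Module.Flat.lTensor_preserves_injective_linearMap (M := B) f hf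
    have hex := lTensor_exact B hfg hg
    -- The image of `φ` in `B ⊗ N₃` vanishes, so `φ` factors through the injection from `B ⊗ N₁`;
    -- injectivity makes the chosen lift linear and zero at `1`.
    have hmem : ∀ b, ∃ y, TensorProduct.AlgebraTensorModule.lTensor A B f y = φ b := fun b =>
      (hex (φ b)).1 (by simpa using DFunLike.congr_fun h0 b)
    choose ψ hψ using hmem
    have h1 := h₁
      { toFun := ψ
        map_add' := fun x y => hinj (by
          change TensorProduct.AlgebraTensorModule.lTensor A B f _ =
            TensorProduct.AlgebraTensorModule.lTensor A B f _
          rw [map_add, hψ, hψ, hψ, map_add])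
        map_smul' := fun c x => hinj (by
          change TensorProduct.AlgebraTensorModule.lTensor A B f _ =
            TensorProduct.AlgebraTensorModule.lTensor A B f _
          rw [RingHom.id_apply, map_smul, hψ, hψ, map_smul]) }
      (hinj (by
        change TensorProduct.AlgebraTensorModule.lTensor A B f (ψ 1) = _
        rw [hψ, hφ, map_zero]))
    ext b
    have hb : ψ b = 0 := DFunLike.congr_fun h1 b
    rw [← hψ, hb, map_zero, LinearMap.zero_apply]

/-! ### Vanishing on a one-dimensional Cohen–Macaulay fiber -/

/-- An element of a ring vanishes if, at each prime, it vanishes locally or the local ring contains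
a regular element that is not a unit. -/
theorem eq_zero_of_locally_zero_or_regular {B : Type u} [CommRing B] (m : B)
    (H : ∀ (q : Ideal B) [q.IsPrime], (∃ t ∉ q, t * m = 0) ∨
      ∃ (S : Type u) (_ : CommRing S) (_ : Algebra B S) (_ : IsLocalization.AtPrime S q) (f : S),
        ¬ IsUnit f ∧ IsSMulRegular S f) : m = 0 := by
  by_contra hm
  let I : Ideal B := LinearMap.ker (LinearMap.toSpanSingleton B B m)
  have hI : ∀ t, t ∈ I ↔ t * m = 0 := fun t => by simp [I]
  have hne : I ≠ ⊤ := fun h => hm (by simpa using (hI 1).1 (h ▸ trivial))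
  -- At a prime `q` minimal over the annihilator `I` of `m`, the radical of `I S` is the maximal
  -- ideal, so a power of `f` kills `m` in `S`, and regularity of `f` gives `m = 0` there.
  obtain ⟨q, hq⟩ := Ideal.nonempty_minimalPrimes hne
  have : q.IsPrime := hq.1.1
  rcases H q with ⟨t, ht, htm⟩ | ⟨S, _, _, _, f, hf, hreg⟩
  · exact ht (hq.1.2 ((hI t).2 htm))
  · have : IsLocalRing S := IsLocalization.AtPrime.isLocalRing S q
    have hrad : f ∈ (I.map (algebraMap B S)).radical := by
      rw [IsLocalization.AtPrime.radical_map_of_mem_minimalPrimes S q I hq,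
        IsLocalization.AtPrime.map_eq_maximalIdeal q S]
      exact hf
    obtain ⟨k, hk⟩ := hrad
    have hz : ∀ x ∈ I.map (algebraMap B S), x * algebraMap B S m = 0 := by
      intro x hx
      refine Submodule.span_induction ?_ ?_ ?_ ?_ hx
      · rintro _ ⟨t, ht, rfl⟩
        rw [← map_mul, (hI t).1 ht, map_zero]
      · simp
      · intro x y _ _ hx hy
        rw [add_mul, hx, hy, add_zero]
      · intro a x _ hx
        rw [smul_eq_mul, mul_assoc, hx, mul_zero]
    have h0 : algebraMap B S m = 0 := (hreg.pow k) (by simpa using hz _ hk)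
    obtain ⟨t, ht⟩ := (IsLocalization.map_eq_zero_iff q.primeCompl S m).1 h0
    exact t.2 (hq.1.2 ((hI t).2 ht))

theorem bijective_app_of_isIso_restrict {X Z : Scheme.{u}} (t : X ⟶ Z) (V : Z.Opens)
    (hV : IsIso (t ∣_ V)) (V' : Z.Opens) (h : V' ≤ V) : Function.Bijective (t.app V').hom := by
  have e : V.ι ''ᵁ (V.ι ⁻¹ᵁ V') = V' := by
    rw [Scheme.Hom.image_preimage_eq_opensRange_inf, Scheme.Opens.opensRange_ι]
    exact inf_eq_right.2 h
  have h1 : IsIso ((t ∣_ V).app (V.ι ⁻¹ᵁ V')) := inferInstance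
  rw [morphismRestrict_app] at h1
  have h2 : IsIso (t.app (V.ι ''ᵁ (V.ι ⁻¹ᵁ V'))) :=
    have aux : ∀ (U₁ U₂ : X.Opens) (h : U₂ = U₁), IsIso (X.presheaf.map (eqToHom h).op) :=
      fun _ _ _ => inferInstance
    @IsIso.of_isIso_comp_right _ _ _ _ _ _ _ (aux _ _ _) h1
  rw [e] at h2
  exact (ConcreteCategory.isIso_iff_bijective _).1 h2

/-- If `t : X ⟶ Z` is an isomorphism over `V` and `ι : Z ⟶ Y` is a closed immersion, then near a
point over `V` every function on `X` comes from `Y`. -/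
theorem exists_pow_mul_eq_app {X Z Y : Scheme.{u}} (t : X ⟶ Z) (ι : Z ⟶ Y) [IsClosedImmersion ι]
    [IsAffineHom t] (V : Z.Opens) (hV : IsIso (t ∣_ V)) {W : Y.Opens} (hW : IsAffineOpen W)
    (b : Γ(X, (t ≫ ι) ⁻¹ᵁ W)) (x : X) (hx : t x ∈ V) (hxW : x ∈ t ⁻¹ᵁ ι ⁻¹ᵁ W) :
    ∃ (h a : Γ(Y, W)) (k : ℕ), x ∈ X.basicOpen (((t ≫ ι).app W).hom h) ∧
      ((t ≫ ι).app W).hom h ^ k * b = ((t ≫ ι).app W).hom a := by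
  change Γ(X, t ⁻¹ᵁ ι ⁻¹ᵁ W) at b
  have hWZ : IsAffineOpen (ι ⁻¹ᵁ W) := hW.preimage ι
  have hWX : IsAffineOpen (t ⁻¹ᵁ ι ⁻¹ᵁ W) := hWZ.preimage t
  obtain ⟨hZ, hle, hxZ⟩ := hWZ.exists_basicOpen_le ⟨t x, hx⟩ hxW
  obtain ⟨h, rfl⟩ := ι.app_surjective W hW hZ
  set hZ := (ι.app W).hom h
  set hX := (t.app (ι ⁻¹ᵁ W)).hom hZ
  have hopen : t ⁻¹ᵁ Z.basicOpen hZ = X.basicOpen hX := Scheme.preimage_basicOpen t hZ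
  have hlocZ := hWZ.isLocalization_basicOpen hZ
  have hiX : t ⁻¹ᵁ Z.basicOpen hZ ≤ t ⁻¹ᵁ ι ⁻¹ᵁ W := hopen ▸ X.basicOpen_le hX
  have hlocX := hWX.isLocalization_of_eq_basicOpen hX (homOfLE hiX) hopen
  obtain ⟨c, hc⟩ := (bijective_app_of_isIso_restrict t V hV _ hle).2
    ((X.presheaf.map (homOfLE hiX).op).hom b)
  obtain ⟨k, aZ, hk⟩ := IsLocalization.Away.surj hZ c
  obtain ⟨a, rfl⟩ := ι.app_surjective W hW aZ
  have hnat : ∀ z : Γ(Z, ι ⁻¹ᵁ W), (t.app (Z.basicOpen hZ)).hom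
      ((Z.presheaf.map (homOfLE (Z.basicOpen_le hZ)).op).hom z) =
      (X.presheaf.map (homOfLE hiX).op).hom ((t.app (ι ⁻¹ᵁ W)).hom z) := fun z =>
    DFunLike.congr_fun (congrArg CommRingCat.Hom.hom
      (t.naturality (homOfLE (Z.basicOpen_le hZ)).op)) z
  have hk' := congrArg (t.app (Z.basicOpen hZ)).hom hk
  let := (X.presheaf.map (homOfLE hiX).op).hom.toAlgebra
  rw [map_mul, map_pow, hc] at hk'
  erw [hnat, hnat] at hk'
  rw [← map_pow, ← map_mul] at hk'
  obtain ⟨⟨_, N, rfl⟩, hN⟩ := (IsLocalization.eq_iff_exists (Submonoid.powers hX)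
    Γ(X, t ⁻¹ᵁ Z.basicOpen hZ)).1 hk'
  -- The power `k` clears the denominator of `c` on the image; `N` turns the resulting equality on
  -- the basic open into one over all of the preimage of `W`.
  refine ⟨h, h ^ N * a, N + k, hopen.le hxZ, ?_⟩
  rw [map_mul, map_pow, Scheme.Hom.comp_app]
  change hX ^ (N + k) * b = hX ^ N * _
  rw [pow_add, mul_assoc, mul_comm (hX ^ k)]
  exact hN

/-- On a scheme all of whose components have dimension one, a point with closed image under a
quasi-finite morphism has a proper generization. -/
theorem HasPureDimension.exists_specializes_ne {X Z : Scheme.{u}} (hX : HasPureDimension X 1)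
    (t : X ⟶ Z) [LocallyQuasiFinite t] (x : X) (hx : IsClosed ({t x} : Set Z)) :
    ∃ y, y ⤳ x ∧ y ≠ x := by
  by_contra! H
  have hirr : IsIrreducible (irreducibleComponent x) := isIrreducible_irreducibleComponent
  have hgen : closure {hirr.genericPoint} = irreducibleComponent x :=
    hirr.closure_genericPoint isClosed_irreducibleComponent
  -- Without proper generizations, `x` is the generic point of its component.
  have hη : hirr.genericPoint = x := H _ (by
    rw [specializes_iff_mem_closure, hgen]; exact mem_irreducibleComponent)
  rw [hη] at hgen
  have hsub : (irreducibleComponent x).Subsingleton := by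
    -- Every point of the component specializes `x`, hence lies over the closed point `t x`; the
    -- fiber there is discrete, so the component is `{x}`, of dimension zero.
    have hdisc := (t.isDiscrete_preimage_singleton (t x)).to_subtype
    have : ∀ y ∈ irreducibleComponent x, y = x := by
      intro y hy
      have hs : x ⤳ y := by rwa [specializes_iff_mem_closure, hgen]
      have hty : t y = t x := by
        have := (hs.map t.continuous).mem_closed hx rfl
        simpa using this
      have hs' : (⟨x, rfl⟩ : t ⁻¹' {t x}) ⤳ ⟨y, hty⟩ := by
        rwa [← Topology.IsInducing.subtypeVal.specializes_iff]
      exact (congrArg Subtype.val hs'.eq).symm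
    intro y hy z hz
    rw [this y hy, this z hz]
  have h1 := hX _ (irreducibleComponent_mem_irreducibleComponents x)
  have : Subsingleton (irreducibleComponent x) := hsub.coe_sort
  have h0 : topologicalKrullDim (irreducibleComponent x) ≤ 0 :=
    topologicalKrullDim_zero_of_discreteTopology _
  rw [h1] at h0
  exact absurd h0 (by norm_num)

/-- A proper generization excludes dimension zero, so the maximal regular sequence is nonempty and
its first entry serves. -/
theorem IsCohenMacaulayScheme.exists_regular {X : Scheme.{u}} (hX : IsCohenMacaulayScheme X)
    {x y : X} (h : y ⤳ x) (hne : y ≠ x) :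
    ∃ f : X.presheaf.stalk x, ¬ IsUnit f ∧ IsSMulRegular (X.presheaf.stalk x) f := by
  obtain ⟨-, rs, hmem, hreg, hdim⟩ := hX x
  cases rs with
  | nil =>
    exfalso
    have h0 : Ring.KrullDimLE 0 (X.presheaf.stalk x) := by
      rw [Ring.krullDimLE_iff, ← hdim]
      simp
    have hall : ∀ z : PrimeSpectrum (X.presheaf.stalk x), z = IsLocalRing.closedPoint _ := by
      intro z
      have : z.asIdeal.IsMaximal := z.isPrime.isMaximal'
      exact PrimeSpectrum.ext (IsLocalRing.eq_maximalIdeal this)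
    obtain ⟨z, hz⟩ : y ∈ Set.range (X.fromSpecStalk x) := by
      rw [Scheme.range_fromSpecStalk]; exact h
    apply hne
    rw [← hz, hall z, Scheme.fromSpecStalk_closedPoint]
  | cons r rs =>
    exact ⟨r, (IsLocalRing.mem_maximalIdeal _).1 (hmem r (by simp)),
      ((RingTheory.Sequence.isRegular_cons_iff _ _ _).1 hreg).1⟩

theorem unitDetectsEnd_app_comp {X Z Y : Scheme.{u}} (t : X ⟶ Z) (ι : Z ⟶ Y) [IsClosedImmersion ι]
    [IsFinite t] (hX : IsCohenMacaulayScheme X) (hX1 : HasPureDimension X 1) (V : Z.Opens)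
    (hcl : ∀ x ∉ V, IsClosed ({x} : Set Z)) (hV : IsIso (t ∣_ V)) {W : Y.Opens}
    (hW : IsAffineOpen W) : UnitDetectsEnd ((t ≫ ι).app W).hom := by
  have hU : IsAffineOpen ((t ≫ ι) ⁻¹ᵁ W) := (hW.preimage ι).preimage t
  intro D hD hD1
  ext b
  refine eq_zero_of_locally_zero_or_regular _ fun q hq => ?_
  let x : X := hU.fromSpec ⟨q, hq⟩
  have hxU : x ∈ (t ≫ ι) ⁻¹ᵁ W := by
    have : x ∈ Set.range hU.fromSpec := ⟨_, rfl⟩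
    rwa [hU.range_fromSpec] at this
  by_cases hx : t x ∈ V
  · left
    obtain ⟨h, a, k, hxh, hba⟩ := exists_pow_mul_eq_app t ι V hV hW b x hx hxU
    refine ⟨((t ≫ ι).app W).hom h ^ k, fun hmem => ?_, ?_⟩
    · have hxh' : (⟨q, hq⟩ : PrimeSpectrum _) ∈
          hU.fromSpec ⁻¹ᵁ X.basicOpen (((t ≫ ι).app W).hom h) := hxh
      rw [hU.fromSpec_preimage_basicOpen] at hxh'
      exact hxh' (hq.mem_of_pow_mem k hmem)
    -- Here `h ^ k * b` is the image of `a`, so `h ^ k * D b = a * D 1 = 0`.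
    · rw [← map_pow, ← hD, map_pow]
      erw [hba]
      have := hD a 1
      rwa [mul_one, hD1, mul_zero] at this
  · right
    obtain ⟨y, hy, hne⟩ := hX1.exists_specializes_ne t x (hcl _ hx)
    obtain ⟨f, hf, hreg⟩ := hX.exists_regular hy hne
    have hpx : hU.primeIdealOf ⟨x, hxU⟩ = ⟨q, hq⟩ :=
      hU.fromSpec.isOpenEmbedding.injective (hU.fromSpec_primeIdealOf ⟨x, hxU⟩)
    have hloc := hU.isLocalization_stalk ⟨x, hxU⟩
    simp only [hpx] at hloc
    exact ⟨_, _, _, hloc, f, hf, hreg⟩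

/-- A finite morphism from a Cohen–Macaulay curve that is an isomorphism onto its image away from
closed points detects endomorphisms on affine opens. -/
theorem unitDetectsEnd_app {X Y : Scheme.{u}} (g : X ⟶ Y) [IsFinite g]
    (hX : IsCohenMacaulayScheme X) (hX1 : HasPureDimension X 1)
    (hg : IsIsoOntoImageAwayFromFinite g) {W : Y.Opens} (hW : IsAffineOpen W) :
    UnitDetectsEnd (g.app W).hom := by
  obtain ⟨V, -, hcl, hV⟩ := hg
  have : IsFinite (g.toImage ≫ g.imageι) := by rwa [Scheme.Hom.toImage_imageι]
  have : IsFinite g.toImage := .of_comp _ g.imageι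
  have key := unitDetectsEnd_app_comp g.toImage g.imageι hX hX1 V hcl hV hW
  rwa [Scheme.Hom.toImage_imageι] at key

/-! ### From fibers to the family -/

theorem UnitDetectsEnd.map_of_isPushout {R A B K : Type u} [CommRing R] [CommRing A] [CommRing B]
    [CommRing K] [Algebra R A] [Algebra R B] [Algebra A B] [IsScalarTower R A B] [Algebra R K]
    {AK BK : CommRingCat.{u}} {a₁ : .of A ⟶ AK} {k₁ : .of K ⟶ AK} {b₁ : .of B ⟶ BK}
    {k₂ : .of K ⟶ BK}
    (hA : IsPushout (CommRingCat.ofHom (algebraMap R A)) (CommRingCat.ofHom (algebraMap R K)) a₁ k₁)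
    (hB : IsPushout (CommRingCat.ofHom (algebraMap R B)) (CommRingCat.ofHom (algebraMap R K)) b₁ k₂)
    {f : AK ⟶ BK} (h₁ : a₁ ≫ f = CommRingCat.ofHom (algebraMap A B) ≫ b₁) (h₂ : k₁ ≫ f = k₂)
    (h : UnitDetectsEnd f.hom) :
    UnitDetectsEnd
      (Algebra.TensorProduct.map (IsScalarTower.toAlgHom R A B) (AlgHom.id R K)).toRingHom := by
  have tA := CommRingCat.isPushout_tensorProduct R A K
  have tB := CommRingCat.isPushout_tensorProduct R B K
  let eA := tA.isoIsPushout _ _ hA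
  let eB := tB.isoIsPushout _ _ hB
  have comm : CommRingCat.ofHom (Algebra.TensorProduct.map (IsScalarTower.toAlgHom R A B)
      (AlgHom.id R K)).toRingHom ≫ eB.hom = eA.hom ≫ f := by
    apply tA.hom_ext
    · have e : CommRingCat.ofHom (Algebra.TensorProduct.includeLeftRingHom : A →+* A ⊗[R] K) ≫
          CommRingCat.ofHom (Algebra.TensorProduct.map (IsScalarTower.toAlgHom R A B)
            (AlgHom.id R K)).toRingHom =
          CommRingCat.ofHom (algebraMap A B) ≫
            CommRingCat.ofHom (Algebra.TensorProduct.includeLeftRingHom : B →+* B ⊗[R] K) := by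
        ext x
        simp
      rw [← Category.assoc, e, Category.assoc, IsPushout.inl_isoIsPushout_hom, ← Category.assoc,
        IsPushout.inl_isoIsPushout_hom, h₁]
    · have e : CommRingCat.ofHom
            (Algebra.TensorProduct.includeRight : K →ₐ[R] A ⊗[R] K).toRingHom ≫
          CommRingCat.ofHom (Algebra.TensorProduct.map (IsScalarTower.toAlgHom R A B)
            (AlgHom.id R K)).toRingHom =
            CommRingCat.ofHom
              (Algebra.TensorProduct.includeRight : K →ₐ[R] B ⊗[R] K).toRingHom := by
        ext x
        simp
      rw [← Category.assoc, e, IsPushout.inr_isoIsPushout_hom, ← Category.assoc,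
        IsPushout.inr_isoIsPushout_hom, h₂]
  exact h.of_ringEquiv eA.hom.hom eA.commRingCatIsoToRingEquiv.surjective
    eB.commRingCatIsoToRingEquiv fun a =>
      DFunLike.congr_fun (congrArg CommRingCat.Hom.hom comm) a

/-- The dévissage is applied with `M = R` to `σ - id`, which kills `1`. -/
theorem algHom_eq_id_of_fiberwise {R A B : Type u} [CommRing R] [IsNoetherianRing R] [CommRing A]
    [CommRing B] [Algebra R A] [Algebra R B] [Algebra A B] [IsScalarTower R A B] [Module.Flat R B]
    (H : ∀ p : PrimeSpectrum R, ∃ (K : Type u) (_ : CommRing K) (_ : Algebra R K),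
      RingHom.ker (algebraMap R K) = p.asIdeal ∧ UnitDetectsEnd
        (Algebra.TensorProduct.map (IsScalarTower.toAlgHom R A B) (AlgHom.id R K)).toRingHom)
    (σ : B →ₐ[A] B) : σ = AlgHom.id A B := by
  have key := linearMap_tensor_eq_zero (A := A) (B := B) (fun p => by
    obtain ⟨K, i₁, i₂, hK, h⟩ := H p
    exact ⟨K, i₁, i₂, hK, fun φ hφ => h.linearMap_eq_zero φ hφ⟩) R
    ((AlgebraTensorModule.rid R A B).symm.toLinearMap.comp (σ.toLinearMap - LinearMap.id))
    (by simp)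
  ext b
  have h := (AlgebraTensorModule.rid R A B).symm.map_eq_zero_iff.1 (DFunLike.congr_fun key b)
  simpa [sub_eq_zero] using h

/-- A function `r` dies in `κ(s)` exactly when the preimage of `D(r)` in `Spec κ(s)` is empty, that
is, when `s ∉ D(r)`. -/
theorem ker_appLE_fromSpecResidueField {S : Scheme.{u}} {U : S.Opens} (hU : IsAffineOpen U)
    (p : PrimeSpectrum Γ(S, U)) (h : ⊤ ≤ S.fromSpecResidueField (hU.fromSpec p) ⁻¹ᵁ U) :
    RingHom.ker ((S.fromSpecResidueField (hU.fromSpec p)).appLE U ⊤ h).hom = p.asIdeal := by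
  set s := hU.fromSpec p
  ext r
  rw [RingHom.mem_ker]
  have h1 : (S.fromSpecResidueField s) ⁻¹ᵁ S.basicOpen r =
      (Spec (S.residueField s)).basicOpen (((S.fromSpecResidueField s).appLE U ⊤ h).hom r) := by
    rw [Scheme.preimage_basicOpen, Scheme.Hom.appLE, CommRingCat.hom_comp, RingHom.comp_apply]
    erw [Scheme.basicOpen_res]
    exact (top_inf_eq _).symm
  have h2 : s ∈ S.basicOpen r ↔ r ∉ p.asIdeal := by
    have : p ∈ hU.fromSpec ⁻¹ᵁ S.basicOpen r ↔ r ∉ p.asIdeal := by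
      rw [hU.fromSpec_preimage_basicOpen]; rfl
    exact this
  rw [← not_iff_not, ← h2, ← basicOpen_eq_bot_iff, ← h1]
  constructor
  · intro hne
    by_contra hs'
    apply hne
    ext x
    simp only [TopologicalSpace.Opens.coe_bot, Set.mem_empty_iff_false, iff_false]
    intro hx
    have hx' : S.fromSpecResidueField s x ∈ S.basicOpen r := hx
    rw [Scheme.fromSpecResidueField_apply] at hx'
    exact hs' hx'
  · intro hs' hbot
    let x : Spec (S.residueField s) := IsLocalRing.closedPoint (S.residueField s)
    have hx : x ∈ S.fromSpecResidueField s ⁻¹ᵁ S.basicOpen r := by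
      change S.fromSpecResidueField s x ∈ S.basicOpen r
      rwa [Scheme.fromSpecResidueField_apply]
    rw [hbot] at hx
    exact hx

/-! ### Projective space and the curve under base change to a fiber -/

/-- The base change `ℙⁿ_T ⟶ ℙⁿ_S` of a morphism `T ⟶ S`. -/
noncomputable def PSpace.map (n : ℕ) {T S : Scheme.{u}} (f : T ⟶ S) : PSpace n T ⟶ PSpace n S :=
  pullback.lift (PSpace.toBase n T ≫ f) (PSpace.toProjInt n T) (terminal.hom_ext _ _)

theorem PSpace.map_toBase (n : ℕ) {T S : Scheme.{u}} (f : T ⟶ S) :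
    PSpace.map n f ≫ PSpace.toBase n S = PSpace.toBase n T ≫ f :=
  pullback.lift_fst _ _ _

theorem PSpace.map_toProjInt (n : ℕ) {T S : Scheme.{u}} (f : T ⟶ S) :
    PSpace.map n f ≫ PSpace.toProjInt n S = PSpace.toProjInt n T :=
  pullback.lift_snd _ _ _

theorem PSpace.hom_ext {n : ℕ} {X S : Scheme.{u}} {f g : X ⟶ PSpace n S}
    (h₁ : f ≫ PSpace.toBase n S = g ≫ PSpace.toBase n S)
    (h₂ : f ≫ PSpace.toProjInt n S = g ≫ PSpace.toProjInt n S) : f = g :=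
  pullback.hom_ext h₁ h₂

theorem PSpace.isPullback_map (n : ℕ) {T S : Scheme.{u}} (f : T ⟶ S) :
    IsPullback (PSpace.map n f) (PSpace.toBase n T) (PSpace.toBase n S) f := by
  have hS : IsPullback (PSpace.toProjInt n S) (PSpace.toBase n S) (terminal.from (ProjInt.{u} n))
    (terminal.from S) := (IsPullback.of_hasPullback _ _).flip
  have hT : IsPullback (PSpace.toProjInt n T) (PSpace.toBase n T) (terminal.from (ProjInt.{u} n))
    (terminal.from T) := (IsPullback.of_hasPullback _ _).flip
  refine IsPullback.of_right (h₁₂ := PSpace.toProjInt n S) (h₂₂ := terminal.from S) ?_ ?_ hS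
  · have e : f ≫ terminal.from S = terminal.from T := terminal.hom_ext _ _
    rwa [PSpace.map_toProjInt, e]
  · exact PSpace.map_toBase n f

/-- The underlying morphism `C ⟶ ℙⁿ_S` of an `S`-morphism. -/
noncomputable def toPSpace {n : ℕ} {S : Scheme.{u}} {C : Over S} (i : C ⟶ PSpace.over n S) :
    C.left ⟶ PSpace n S :=
  i.left

theorem toPSpace_toBase {n : ℕ} {S : Scheme.{u}} {C : Over S} (i : C ⟶ PSpace.over n S) :
    toPSpace i ≫ PSpace.toBase n S = C.hom :=
  Over.w i

section Fiber

variable {n : ℕ} {S : Scheme.{u}} {C : Over S} (i : C ⟶ PSpace.over n S) (s : S)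

theorem fiberMap_toBase : fiberMap i s ≫ PSpace.toBase n _ = C.hom.fiberToSpecResidueField s :=
  pullback.lift_fst _ _ _

theorem fiberMap_toProjInt :
    fiberMap i s ≫ PSpace.toProjInt n _ = C.hom.fiberι s ≫ toPSpace i ≫ PSpace.toProjInt n S :=
  pullback.lift_snd _ _ _

theorem fiberMap_map :
    fiberMap i s ≫ PSpace.map n (S.fromSpecResidueField s) = C.hom.fiberι s ≫ toPSpace i := by
  apply PSpace.hom_ext
  · rw [Category.assoc, PSpace.map_toBase, ← Category.assoc, fiberMap_toBase, Category.assoc, toPSpace_toBase,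
      Scheme.Hom.fiber_fac]
  · rw [Category.assoc, PSpace.map_toProjInt, fiberMap_toProjInt, Category.assoc]

/-- Cancelling the cartesian square of projective spaces from that of the fiber exhibits `i_s` as a
base change of `i`; in particular it inherits finiteness. -/
theorem isPullback_fiberMap :
    IsPullback (C.hom.fiberι s) (fiberMap i s) (toPSpace i) (PSpace.map n (S.fromSpecResidueField s)) := by
  refine IsPullback.of_bot (v₂₁ := PSpace.toBase n _) (v₂₂ := PSpace.toBase n S) ?_
    (fiberMap_map i s).symm (PSpace.isPullback_map n _)
  rw [fiberMap_toBase, toPSpace_toBase]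
  exact IsPullback.of_hasPullback _ _

end Fiber

/-! ### Rigidity of the family -/

theorem appLE_congr_hom {X Y : Scheme.{u}} {f g : X ⟶ Y} (h : f = g) (U : Y.Opens) (V : X.Opens)
    (e : V ≤ f ⁻¹ᵁ U) : f.appLE U V e = g.appLE U V (h ▸ e) := by
  subst h
  rfl

/-- A morphism over `i` acts trivially on functions over an affine open of projective space. -/
theorem CMPair.appLE_eq_id {n : ℕ} {p : Polynomial ℤ} {S : Scheme.{u}} [IsLocallyNoetherian S]
    (X : CMPair n p S) (α : X.C.left ⟶ X.C.left) (hα : α ≫ toPSpace X.i = toPSpace X.i)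
    {S₀ : S.Opens} (hS₀ : IsAffineOpen S₀) {W : (PSpace n S).Opens} (hW : IsAffineOpen W)
    (hWS : W ≤ PSpace.toBase n S ⁻¹ᵁ S₀) (hU : (toPSpace X.i) ⁻¹ᵁ W ≤ α ⁻¹ᵁ (toPSpace X.i) ⁻¹ᵁ W) :
    α.appLE ((toPSpace X.i) ⁻¹ᵁ W) ((toPSpace X.i) ⁻¹ᵁ W) hU = 𝟙 _ := by
  have hfin : IsFinite (toPSpace X.i) := X.finite
  have hflat : Flat X.C.hom := X.flat
  have hUaff : IsAffineOpen ((toPSpace X.i) ⁻¹ᵁ W) := hW.preimage (toPSpace X.i)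
  have hUS : (toPSpace X.i) ⁻¹ᵁ W ≤ X.C.hom ⁻¹ᵁ S₀ := by
    rw [← toPSpace_toBase X.i]
    exact fun x hx => hWS hx
  let _ : Algebra Γ(S, S₀) Γ(PSpace n S, W) := ((PSpace.toBase n S).appLE S₀ W hWS).hom.toAlgebra
  let _ : Algebra Γ(S, S₀) Γ(X.C.left, (toPSpace X.i) ⁻¹ᵁ W) := (X.C.hom.appLE S₀ _ hUS).hom.toAlgebra
  let _ : Algebra Γ(PSpace n S, W) Γ(X.C.left, (toPSpace X.i) ⁻¹ᵁ W) := ((toPSpace X.i).app W).hom.toAlgebra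
  have hcomp : X.C.hom.appLE S₀ ((toPSpace X.i) ⁻¹ᵁ W) hUS =
      (PSpace.toBase n S).appLE S₀ W hWS ≫ (toPSpace X.i).app W := by
    rw [Scheme.Hom.app_eq_appLE, Scheme.Hom.appLE_comp_appLE]
    simp only [toPSpace_toBase]
  have : IsScalarTower Γ(S, S₀) Γ(PSpace n S, W) Γ(X.C.left, (toPSpace X.i) ⁻¹ᵁ W) :=
    .of_algebraMap_eq' (congrArg CommRingCat.Hom.hom hcomp)
  have : Module.Flat Γ(S, S₀) Γ(X.C.left, (toPSpace X.i) ⁻¹ᵁ W) := hflat.flat_appLE hS₀ hUaff hUS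
  have : IsNoetherianRing Γ(S, S₀) := IsLocallyNoetherian.component_noetherian ⟨S₀, hS₀⟩
  have hσ : (toPSpace X.i).app W ≫ α.appLE _ _ hU = (toPSpace X.i).app W := by
    rw [Scheme.Hom.app_eq_appLE, Scheme.Hom.appLE_comp_appLE]
    simp only [hα]
  have key := algHom_eq_id_of_fiberwise (R := Γ(S, S₀)) (A := Γ(PSpace n S, W)) (fun q => ?_)
    { (α.appLE ((toPSpace X.i) ⁻¹ᵁ W) ((toPSpace X.i) ⁻¹ᵁ W) hU).hom with
      commutes' := fun a => DFunLike.congr_fun (congrArg CommRingCat.Hom.hom hσ) a }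
  · ext b
    exact DFunLike.congr_fun key b
  · let s : S := hS₀.fromSpec q
    have hs : s ∈ S₀ := by
      have : s ∈ Set.range hS₀.fromSpec := ⟨_, rfl⟩
      rwa [hS₀.range_fromSpec] at this
    have htop : ⊤ ≤ S.fromSpecResidueField s ⁻¹ᵁ S₀ := fun x _ => by
      change S.fromSpecResidueField s x ∈ S₀
      rwa [Scheme.fromSpecResidueField_apply]
    have hTaff : IsAffineOpen (⊤ : (Spec (S.residueField s)).Opens) := isAffineOpen_top _
    let k := (S.fromSpecResidueField s).appLE S₀ ⊤ htop
    refine ⟨Γ(Spec (S.residueField s), ⊤), inferInstance, k.hom.toAlgebra,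
      ker_appLE_fromSpecResidueField hS₀ q htop, ?_⟩
    let g := fiberMap X.i s
    let q' := PSpace.map n (S.fromSpecResidueField s)
    have hgq : g ≫ q' = X.C.hom.fiberι s ≫ toPSpace X.i := fiberMap_map X.i s
    have hpb : IsPullback (X.C.hom.fiberι s) g (toPSpace X.i) q' := isPullback_fiberMap X.i s
    have hgfin : IsFinite g := MorphismProperty.of_isPullback (P := @IsFinite) hpb hfin
    -- On affine opens the functions on the fibers are tensor products with `κ(s)`: `hA` says so for
    -- projective space, `hB` for the curve.
    have hA := (isIso_pushoutSection_iff (PSpace.isPullback_map n (S.fromSpecResidueField s)) htop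
      hWS (UY := q' ⁻¹ᵁ W) (by simp [q'])).1 (isIso_pushoutSection_of_isAffineOpen _ _ _ _ hS₀ hTaff hW)
    have hq'W : IsAffineOpen (q' ⁻¹ᵁ W) := by
      have : IsAffine _ := hS₀
      have : IsAffine _ := hTaff
      have : IsAffine _ := hW
      exact .of_isIso (Scheme.Hom.isPullback_resLE (PSpace.isPullback_map n
        (S.fromSpecResidueField s)) htop hWS (UY := q' ⁻¹ᵁ W) (by simp [q'])).isoPullback.hom
    have hC : IsPullback (X.C.hom.fiberι s) (X.C.hom.fiberToSpecResidueField s) X.C.hom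
        (S.fromSpecResidueField s) := IsPullback.of_hasPullback _ _
    have hUY : g ⁻¹ᵁ q' ⁻¹ᵁ W = X.C.hom.fiberι s ⁻¹ᵁ (toPSpace X.i) ⁻¹ᵁ W := by
      rw [← Scheme.Hom.comp_preimage, hgq, Scheme.Hom.comp_preimage]
    have hB := (isIso_pushoutSection_iff hC htop hUS (UY := g ⁻¹ᵁ q' ⁻¹ᵁ W)
      (by rw [hUY]; simp)).1 (isIso_pushoutSection_of_isAffineOpen _ _ _ _ hS₀ hTaff hUaff)
    have hdet : UnitDetectsEnd (g.app (q' ⁻¹ᵁ W)).hom :=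
      unitDetectsEnd_app g (X.cohenMacaulay s) (X.pureDimension s) (X.isoOntoImage s)
        hq'W
    let _ : Algebra Γ(S, S₀) Γ(Spec (S.residueField s), ⊤) := k.hom.toAlgebra
    refine UnitDetectsEnd.map_of_isPushout hA hB ?_ ?_ hdet
    · rw [Scheme.Hom.app_eq_appLE]
      refine (Scheme.Hom.appLE_comp_appLE _ _ _ _ _ _ _).trans ?_
      change _ = (toPSpace X.i).app W ≫ _
      rw [Scheme.Hom.app_eq_appLE]
      exact (appLE_congr_hom (fiberMap_map X.i s) _ _ _).trans
        (Scheme.Hom.appLE_comp_appLE _ _ _ _ _ _ _).symm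
    · rw [Scheme.Hom.app_eq_appLE]
      exact (Scheme.Hom.appLE_comp_appLE _ _ _ _ _ _ _).trans
        (appLE_congr_hom (fiberMap_toBase X.i s) _ _ _)

theorem CMPair.hom_eq_id {n : ℕ} {p : Polynomial ℤ} {S : Scheme.{u}} [IsLocallyNoetherian S]
    (X : CMPair n p S) (α : X.C.left ⟶ X.C.left) (hα : α ≫ toPSpace X.i = toPSpace X.i) : α = 𝟙 _ := by
  have hfin : IsFinite (toPSpace X.i) := X.finite
  refine Scheme.hom_ext_of_forall _ _ fun x => ?_
  obtain ⟨_, ⟨S₀, hS₀, rfl⟩, hxS, -⟩ := S.isBasis_affineOpens.exists_subset_of_mem_open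
    (Set.mem_univ (PSpace.toBase n S (toPSpace X.i x))) isOpen_univ
  obtain ⟨_, ⟨W, hW, rfl⟩, hxW, hWS⟩ := (PSpace n S).isBasis_affineOpens.exists_subset_of_mem_open
    hxS (PSpace.toBase n S ⁻¹ᵁ S₀).isOpen
  have hU : (toPSpace X.i) ⁻¹ᵁ W ≤ α ⁻¹ᵁ (toPSpace X.i) ⁻¹ᵁ W := by
    rw [← Scheme.Hom.comp_preimage]
    simp only [hα]
    exact le_rfl
  have hUaff : IsAffineOpen ((toPSpace X.i) ⁻¹ᵁ W) := hW.preimage (toPSpace X.i)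
  refine ⟨(toPSpace X.i) ⁻¹ᵁ W, hxW, ?_⟩
  have h := hUaff.SpecMap_appLE_fromSpec α hUaff hU
  rw [X.appLE_eq_id α hα hS₀ hW hWS hU, Spec.map_id, Category.id_comp] at h
  have h' : hUaff.fromSpec ≫ α = hUaff.fromSpec ≫ 𝟙 _ := by rw [← h, Category.comp_id]
  rwa [IsAffineOpen.fromSpec, Category.assoc, Category.assoc, cancel_epi] at h'

end CMCurves

theorem mainTheorem6 (n : ℕ) (p : Polynomial ℤ) (hp : p.natDegree = 1)
    (S : Scheme.{u}) [IsLocallyNoetherian S] :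
    (∀ (X : CMCurves.CMPair n p S) (α : X.C ≅ X.C), α.hom ≫ X.i = X.i → α = Iso.refl X.C) ∧
    (∀ (X₁ X₂ : CMCurves.CMPair n p S) (β₁ β₂ : X₁.C ≅ X₂.C),
      β₁.hom ≫ X₂.i = X₁.i → β₂.hom ≫ X₂.i = X₁.i → β₁ = β₂) := by
  have hid : ∀ (X : CMCurves.CMPair n p S) (α : X.C ≅ X.C), α.hom ≫ X.i = X.i →
      α = Iso.refl X.C := fun X α hα =>
    Iso.ext (Over.OverMorphism.ext (X.hom_eq_id α.hom.left (congrArg CommaMorphism.left hα)))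
  refine ⟨hid, fun X₁ X₂ β₁ β₂ h₁ h₂ => ?_⟩
  have h := hid X₁ (β₁ ≪≫ β₂.symm) (by
    rw [Iso.trans_hom, Iso.symm_hom, Category.assoc, ← h₂, Iso.inv_hom_id_assoc, h₁, h₂])
  calc β₁ = (β₁ ≪≫ β₂.symm) ≪≫ β₂ := by simp
    _ = β₂ := by rw [h, Iso.refl_trans]
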